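/- All digraphs are finite, have at least one vertex, and have no loops and no parallel arcs; cycles and paths are directed, a cycle has at least two vertices (cycles of length $2$ are allowed), and a single vertex is a path. Let $T$ be a digraph with vertices $u_1,\dots,u_t$, $t\ge 2$, and let $H_1,\dots,H_t$ be digraphs, where $H_i$ has $n_i\ge 1$ vertices. The composition $T[H_1,\dots,H_t]$ is the digraph on the disjoint union of the vertex sets $V(H_i)$ whose arcs are the arcs of the $H_i$ together with all arcs from vertices of $H_i$ to vertices of $H_j$ whenever $u_iu_j$ is an arc of $T$. Let $\overline{K}_p$ be the digraph with $p$ vertices and no arcs. For a digraph $D$, a cycle subdigraph of $D$ is a collection of pairwise vertex-disjoint cycles of $D$, and $pc(D)$ is the smallest $k$ such that $V(D)$ can be covered by $k$ pairwise vertex-disjoint paths of $D$. Theorem. Suppose that $T$ is semicomplete, that is, any two distinct vertices of $T$ are joined by at least one arc, and that $Q=T[H_1,\dots,H_t]$ is strong. Then $Q$ has a Hamiltonian cycle if and only if the extended semicomplete digraph $Q'=T[\overline{K}_{n_1},\dots,\overline{K}_{n_t}]$ has a cycle subdigraph which covers at least $pc(H_i)$ vertices of $\overline{K}_{n_i}$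 for every $i\in\{1,\dots,t\}$. -/

import Mathlib

namespace Digraph

/-- A digraph has no loops. -/
def IsLoopless {V : Type*} (D : Digraph V) : Prop :=
  ∀ x, ¬ D.Adj x x

/-- There is at least one arc between any two distinct vertices. -/
def IsSemicomplete {V : Type*} (D : Digraph V) : Prop :=
  ∀ x y, x ≠ y → D.Adj x y ∨ D.Adj y x

/-- Every vertex can be reached from every vertex along arcs. -/
def IsStrong {V : Type*} (D : Digraph V) : Prop :=
  ∀ x y, Relation.ReflTransGen D.Adj x y

/-- The list `p` is the vertex sequence of a (directed) path of `D`; a single vertex is a path. -/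
def IsPath {V : Type*} (D : Digraph V) (p : List V) : Prop :=
  p ≠ [] ∧ p.Nodup ∧ p.IsChain D.Adj

/-- The cyclic sequence `c` is the vertex sequence of a (directed) cycle of `D`:
it has at least two vertices, they are distinct, and each of them dominates the next one,
cyclically. Cycles of length two are allowed. -/
def IsCycle {V : Type*} (D : Digraph V) (c : Cycle V) : Prop :=
  c.Nontrivial ∧ c.Nodup ∧ c.Chain D.Adj

/-- `D` has a cycle through all its vertices. -/
def IsHamiltonian {V : Type*} (D : Digraph V) : Prop :=
  ∃ c : Cycle V, D.IsCycle c ∧ ∀ v, v ∈ c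

/-- The paths `P 0, …, P (k - 1)` are pairwise vertex-disjoint and cover all vertices of `D`. -/
structure IsPathFactor {V : Type*} (D : Digraph V) {k : ℕ} (P : Fin k → List V) : Prop where
  isPath : ∀ a, D.IsPath (P a)
  disjoint : ∀ a b, a ≠ b → ∀ v, v ∈ P a → v ∉ P b
  spanning : ∀ v, ∃ a, v ∈ P a

/-- The smallest `k` such that `D` has a `k`-path factor. -/
noncomputable def pathCoveringNumber {V : Type*} (D : Digraph V) : ℕ :=
  sInf {k : ℕ | ∃ P : Fin k → List V, D.IsPathFactor P}

/-- A finite digraph has a path factor, so that the path covering number is a genuine minimum. -/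
theorem exists_isPathFactor {V : Type*} [Fintype V] (D : Digraph V) :
    ∃ P : Fin (Fintype.card V) → List V, D.IsPathFactor P := by
  refine ⟨fun a => [(Fintype.equivFin V).symm a], ?_, ?_, ?_⟩
  · intro a
    simp [IsPath]
  · intro a b hab v hv hv'
    simp only [List.mem_singleton] at hv hv'
    exact hab ((Fintype.equivFin V).symm.injective (hv.symm.trans hv'))
  · intro v
    exact ⟨Fintype.equivFin V v, by simp⟩

/-- The cycles `F 0, …, F (m - 1)` of `D` are pairwise vertex-disjoint. -/
structure IsCycleSubdigraph {V : Type*} (D : Digraph V) {m : ℕ} (F : Fin m → Cycle V) :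
    Prop where
  isCycle : ∀ a, D.IsCycle (F a)
  disjoint : ∀ a b, a ≠ b → ∀ v, v ∈ F a → v ∉ F b

/-- The arcs of the composition `T[H i : i]`: those of the digraphs `H i`, and all arcs from
`V i` to `V j` whenever `i` dominates `j` in `T`. -/
inductive CompositionAdj {ι : Type*} {V : ι → Type*} (T : Digraph ι) (H : ∀ i, Digraph (V i)) :
    (Σ i, V i) → (Σ i, V i) → Prop
  | inside {i : ι} {x y : V i} (h : (H i).Adj x y) : CompositionAdj T H ⟨i, x⟩ ⟨i, y⟩
  | across {i j : ι} {x : V i} {y : V j} (h : T.Adj i j) : CompositionAdj T H ⟨i, x⟩ ⟨j, y⟩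

/-- The composition `T[H i : i]`, on the disjoint union of the vertex sets of the `H i`. -/
def composition {ι : Type*} {V : ι → Type*} (T : Digraph ι) (H : ∀ i, Digraph (V i)) :
    Digraph (Σ i, V i) where
  Adj := CompositionAdj T H

/-- The extension of `T` in which the vertex `i` is replaced by the digraph of order `n i`
without arcs. -/
def extension {ι : Type*} (T : Digraph ι) (n : ι → ℕ) : Digraph (Σ i, Fin (n i)) :=
  T.composition fun i => Digraph.emptyDigraph (Fin (n i))

end Digraph

/-! Both sides amount to a closed walk of `T` that visits each `i` exactly `k i` times, where `pc(H
i) ≤ k i ≤ n i`. A Hamiltonian cycle of `Q`, cut at its arcs that come from `T`, splits each `H i`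
into `k i` paths; contracting these gives the closed walk. Conversely, `H i` splits into `k i` paths
for every `k i` in this range (`PartitionsIntoPaths.mono`), and substituting them for the visits to
`i` (`Digraph.walk_composition`) gives a Hamiltonian cycle. Applied to arcless parts, the same
substitution turns the closed walk into a cycle of `Q'`.

A cycle subdigraph of `Q'` projects to several closed walks of `T`, which together cover `T` because
`pc(H i) > 0`. The heart of the proof is `ClosedWalk.sum`: as `T` is strong and semicomplete, they
merge into one walk with the same visit counts. Two closed walks that do not merge are related by
strict domination (`ClosedWalk.dominates`), three in cyclic domination merge, and domination without
such triples contradicts strongness. Only multiplicities of vertices matter, so walks carry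
multisets. -/

/-- `Walk R a b s`: there is an `R`-walk from `a` to `b` whose multiset of vertices is `s`. -/
inductive Walk {α : Type*} (R : α → α → Prop) : α → α → Multiset α → Prop
  | single (a : α) : Walk R a a {a}
  | cons {a b c : α} {s : Multiset α} (h : R a b) (w : Walk R b c s) : Walk R a c (a ::ₘ s)

/-- `ClosedWalk R s`: there is a closed `R`-walk whose multiset of vertices is `s`. -/
def ClosedWalk {α : Type*} (R : α → α → Prop) (s : Multiset α) : Prop :=
  ∃ a b, Walk R a b s ∧ R b a

/-- Every vertex of `s` strictly dominates every vertex of `t`. -/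
def Dominates {α : Type*} (R : α → α → Prop) (s t : Multiset α) : Prop :=
  ∀ x ∈ s, ∀ y ∈ t, R x y ∧ ¬ R y x

/-! ### Merging closed walks in a semicomplete digraph -/

section Walks

variable {α : Type*} {R : α → α → Prop}

theorem Walk.append {a b c d : α} {s t : Multiset α} (w : Walk R a b s) (h : R b c)
    (w' : Walk R c d t) : Walk R a d (s + t) := by
  induction w with
  | single a => simpa using Walk.cons h w'
  | cons h' _ ih => simpa using Walk.cons h' (ih h)

theorem Walk.flip {a b : α} {s : Multiset α} (w : Walk R a b s) :
    Walk (fun x y => R y x) b a s := by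
  induction w with
  | single a => exact .single a
  | @cons a b c s h _ ih =>
    have := ih.append (R := fun x y => R y x) h (.single a)
    rwa [add_comm, Multiset.singleton_add] at this

theorem ClosedWalk.flip {s : Multiset α} (w : ClosedWalk R s) :
    ClosedWalk (fun x y => R y x) s := by
  obtain ⟨a, b, w, h⟩ := w
  exact ⟨b, a, w.flip, h⟩

theorem Walk.exists_function {a b : α} {s : Multiset α} (w : Walk R a b s) :
    ∃ (m : ℕ) (f : ℕ → α), f 0 = a ∧ f m = b ∧ (∀ k < m, R (f k) (f (k + 1))) ∧
      s = (Multiset.range (m + 1)).map f := by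
  induction w with
  | single a => exact ⟨0, fun _ => a, rfl, rfl, by simp, by simp⟩
  | @cons a b c s h _ ih =>
    obtain ⟨m, f, h0, hm, hf, rfl⟩ := ih
    refine ⟨m + 1, fun k => Nat.casesOn k a f, rfl, hm, ?_, ?_⟩
    · rintro (_ | k) hk
      · simpa [h0] using h
      · exact hf k (by omega)
    · rw [show (m + 1 + 1) = 1 + (m + 1) by ring, Multiset.range_add 1, Multiset.map_add,
        Multiset.map_map]
      simpa [add_comm 1] using Multiset.cons_swap _ _ _

theorem walk_of_function {f : ℕ → α} (hf : ∀ k, R (f k) (f (k + 1))) (i m : ℕ) :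
    Walk R (f i) (f (i + m)) ((Multiset.range (m + 1)).map fun k => f (i + k)) := by
  induction m with
  | zero => simpa using Walk.single (f i)
  | succ m ih =>
    rw [Multiset.range_succ, Multiset.map_cons, ← Multiset.singleton_add, add_comm {_}]
    exact ih.append (hf _) (.single _)

theorem ClosedWalk.exists_periodic {s : Multiset α} (w : ClosedWalk R s) :
    ∃ (m : ℕ) (f : ℕ → α), (∀ k, f (k + (m + 1)) = f k) ∧ (∀ k, R (f k) (f (k + 1))) ∧
      s = (Multiset.range (m + 1)).map f := by
  obtain ⟨a, b, w, h⟩ := w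
  obtain ⟨m, f, rfl, rfl, hf, rfl⟩ := w.exists_function
  refine ⟨m, fun k => f (k % (m + 1)), by simp, fun k => ?_, ?_⟩
  · have hk := Nat.mod_lt k (show 0 < m + 1 by omega)
    dsimp only
    rw [Nat.add_mod]
    rcases Nat.lt_or_ge (k % (m + 1)) m with h' | h'
    · have : (k % (m + 1) + 1 % (m + 1)) % (m + 1) = k % (m + 1) + 1 := by
        rw [Nat.mod_eq_of_lt (a := 1) (by omega), Nat.mod_eq_of_lt (by omega)]
      rw [this]
      exact hf _ h'
    · have e : k % (m + 1) = m := by omega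
      rw [e]
      simpa using h
  · refine Multiset.map_congr rfl fun k hk => ?_
    rw [Nat.mod_eq_of_lt (Multiset.mem_range.1 hk)]

theorem map_range_shift {f : ℕ → α} {m : ℕ} (hf : ∀ k, f (k + m) = f k) (i : ℕ) :
    (Multiset.range m).map (fun k => f (i + k)) = (Multiset.range m).map f := by
  induction i with
  | zero => simp
  | succ i ih =>
    rw [← ih]
    have h1 : (Multiset.range (m + 1)).map (fun k => f (i + k)) =
        f (i + m) ::ₘ (Multiset.range m).map (fun k => f (i + k)) := by
      simp [Multiset.range_succ]
    have h2 : (Multiset.range (m + 1)).map (fun k => f (i + k)) =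
        f i ::ₘ (Multiset.range m).map (fun k => f (i + 1 + k)) := by
      rw [add_comm m 1, Multiset.range_add, Multiset.map_add, Multiset.map_map]
      simp [Multiset.range_succ, add_assoc]
    rw [hf, h2] at h1
    exact (Multiset.cons_inj_right _).1 h1

/-- A closed walk can be opened at any of its arcs. -/
theorem walk_of_periodic {f : ℕ → α} {m : ℕ} (hp : ∀ k, f (k + (m + 1)) = f k)
    (hf : ∀ k, R (f k) (f (k + 1))) (i : ℕ) :
    Walk R (f (i + 1)) (f i) ((Multiset.range (m + 1)).map f) := by
  have := walk_of_function hf (i + 1) m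
  rwa [map_range_shift hp, show i + 1 + m = i + (m + 1) by ring, hp] at this

/-- Two walks traversed in opposite directions, interleaved. -/
theorem walk_interleave {f g : ℕ → α} (hfg : ∀ k, R (f k) (g (k + 1)))
    (hgf : ∀ k, R (g k) (f k)) (m : ℕ) :
    Walk R (f 0) (g (m + 1)) ((Multiset.range (m + 1)).map f +
      (Multiset.range (m + 1)).map fun k => g (1 + k)) := by
  induction m with
  | zero => simpa using Walk.cons (hfg 0) (.single (g 1))
  | succ m ih =>
    have := ih.append (hgf _) (Walk.cons (hfg (m + 1)) (.single _))
    convert this using 1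
    rw [Multiset.range_succ (m + 1), Multiset.map_cons, Multiset.map_cons, add_comm 1 (m + 1)]
    simp only [← Multiset.singleton_add]
    abel

/-- The zigzag `f 0, g 1, f 1, g 2, …` uses up `f` first, as `m ≤ n`; the rest of `g` is then
followed to `g (n + 1) = g 0`, which dominates `f 0`. -/
theorem closedWalk_interleave {f g : ℕ → α} {m n : ℕ} (hmn : m ≤ n)
    (hg : ∀ k, g (k + (n + 1)) = g k) (hgR : ∀ k, R (g k) (g (k + 1)))
    (hfg : ∀ k, R (f k) (g (k + 1))) (hgf : ∀ k, R (g k) (f k)) :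
    ClosedWalk R ((Multiset.range (m + 1)).map f + (Multiset.range (n + 1)).map g) := by
  have hw := walk_interleave hfg hgf m
  have hg0 : g (n + 1) = g 0 := by simpa using hg 0
  rw [← map_range_shift hg 1]
  rcases hmn.eq_or_lt with rfl | hlt
  · exact ⟨_, _, hw, hg0 ▸ hgf 0⟩
  · obtain ⟨d, rfl⟩ : ∃ d, n = m + 1 + d := ⟨n - (m + 1), by omega⟩
    have hw' := hw.append (hgR _) (walk_of_function hgR (m + 1 + 1) d)
    refine ⟨f 0, g (m + 1 + 1 + d), ?_, ?_⟩
    · convert hw' using 1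
      rw [show m + 1 + d + 1 = m + 1 + (d + 1) by ring, Multiset.range_add (m + 1) (d + 1),
        Multiset.map_add, Multiset.map_map, add_assoc]
      simp only [Function.comp_def]
      congr 2
      refine Multiset.map_congr rfl fun k _ => ?_
      rw [show 1 + (m + 1 + k) = m + 1 + 1 + k by ring]
    · rw [show m + 1 + 1 + d = m + 1 + d + 1 by ring, hg0]
      exact hgf 0

theorem ClosedWalk.dominates_of_card_le (hR : ∀ x y, x ≠ y → R x y ∨ R y x) {s t : Multiset α}
    (hs : ClosedWalk R s) (ht : ClosedWalk R t) (hst : ¬ ClosedWalk R (s + t))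
    (hcard : s.card ≤ t.card) : Dominates R s t ∨ Dominates R t s := by
  -- `f` runs against the arcs, so that the arcs between `f` and `g` propagate with both indices
  -- increasing.
  obtain ⟨m, f, hf, hfR, rfl⟩ := hs.flip.exists_periodic
  obtain ⟨n, g, hg, hgR, rfl⟩ := ht.exists_periodic
  simp only [Multiset.card_map, Multiset.card_range] at hcard
  have hfmul : ∀ c k, f (k + c * (m + 1)) = f k := by
    intro c k
    induction c with
    | zero => simp
    | succ c ih => rw [add_mul, one_mul, ← add_assoc, hf, ih]
  have hgmul : ∀ c k, g (k + c * (n + 1)) = g k := by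
    intro c k
    induction c with
    | zero => simp
    | succ c ih => rw [add_mul, one_mul, ← add_assoc, hg, ih]
  -- Otherwise the walk `s` from `f i` to `f (i + 1)` and the walk `t` from `g (j + 1)` to `g j` are
  -- spliced together.
  have hA : ∀ i j, R (f (i + 1)) (g (j + 1)) → ¬ R (g j) (f i) := fun i j h1 h2 =>
    hst ⟨_, _, (walk_of_periodic hf hfR i).flip.append h1 (walk_of_periodic hg hgR j), h2⟩
  have hne : ∀ i j, f i ≠ g j := by
    intro i j h
    have h' : f (i + m + 1) = g j := by rw [← h, add_assoc, hf]
    refine hA (i + m) j (h' ▸ hgR j) (h' ▸ hfR (i + m))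
  have hstep : ∀ i j, R (g j) (f i) → R (g (j + 1)) (f (i + 1)) := fun i j h =>
    (hR _ _ (hne (i + 1) (j + 1))).resolve_left fun h' => hA i j h' h
  have hiter : ∀ k i j, R (g j) (f i) → R (g (j + k)) (f (i + k)) := by
    intro k i j h
    induction k with
    | zero => exact h
    | succ k ih => exact hstep _ _ ih
  obtain ⟨p, hpf, hpg⟩ : ∃ p, (∀ k, f (k + (p + 1)) = f k) ∧ ∀ k, g (k + (p + 1)) = g k := by
    refine ⟨(n + 1) * (m + 1) - 1, fun k => ?_, fun k => ?_⟩
    · rw [Nat.sub_add_cancel (Nat.mul_pos n.succ_pos m.succ_pos), hfmul]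
    · rw [Nat.sub_add_cancel (Nat.mul_pos n.succ_pos m.succ_pos), mul_comm, hgmul]
  -- Going forward by the rest of a common period amounts to one step back.
  have hback : ∀ i j, R (g (j + 1)) (f (i + 1)) → R (g j) (f i) := by
    intro i j h
    have := hiter p _ _ h
    rwa [add_assoc, add_assoc, add_comm 1 p, hpf, hpg] at this
  have hanti : ∀ i j, R (g j) (f i) → ¬ R (f i) (g j) := by
    intro i j h h'
    refine hA (i + p) (j + p) ?_ (hiter p _ _ h)
    rwa [add_assoc, add_assoc, hpf, hpg]
  have hstep' : ∀ i j, R (f i) (g j) → R (f (i + 1)) (g (j + 1)) := fun i j h =>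
    (hR _ _ (hne _ _)).resolve_right fun h' => hanti _ _ (hback _ _ h') h
  have hiter' : ∀ k i j, R (f i) (g j) → R (f (i + k)) (g (j + k)) := by
    intro k i j h
    induction k with
    | zero => exact h
    | succ k ih => exact hstep' _ _ ih
  -- If `g j` dominates `f i` but not conversely `g (j + 1)`, both diagonals of arcs persist and the
  -- zigzag merges the walks.
  have hmono : ∀ i j, R (g j) (f i) → R (g (j + 1)) (f i) := by
    intro i j h
    by_contra h'
    have h'' := (hR _ _ (hne i (j + 1))).resolve_right h'
    apply hst
    rw [← map_range_shift hf i, ← map_range_shift hg j]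
    refine closedWalk_interleave (by omega) (fun k => ?_) (fun k => hgR _) (fun k => ?_)
      fun k => ?_
    · rw [← add_assoc, hg]
    · have := hiter' k _ _ h''
      rwa [add_right_comm] at this
    · exact hiter k _ _ h
  have hmono' : ∀ k i j, R (g j) (f i) → R (g (j + k)) (f i) := by
    intro k i j h
    induction k with
    | zero => exact h
    | succ k ih => exact hmono _ _ ih
  have hall : ∀ i j j', R (g j) (f i) → R (g j') (f i) := by
    intro i j j' h
    have := hmono' (j' + j * n) i j h
    rwa [show j + (j' + j * n) = j' + j * (n + 1) by ring, hgmul] at this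
  have hall' : ∀ i i' j j', R (g j) (f i) → R (g j') (f i') := by
    intro i i' j j' h
    have := hiter (i' + i * m) i j h
    rw [show i + (i' + i * m) = i' + i * (m + 1) by ring, hfmul] at this
    exact hall _ _ _ this
  by_cases h : R (g 0) (f 0)
  · right
    simp only [Dominates, Multiset.mem_map]
    rintro _ ⟨j, -, rfl⟩ _ ⟨i, -, rfl⟩
    have := hall' 0 i 0 j h
    exact ⟨this, hanti _ _ this⟩
  · left
    simp only [Dominates, Multiset.mem_map]
    rintro _ ⟨i, -, rfl⟩ _ ⟨j, -, rfl⟩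
    have : ¬ R (g j) (f i) := fun h' => h (hall' i 0 j 0 h')
    exact ⟨(hR _ _ (hne i j)).resolve_right this, this⟩

/-- In a semicomplete digraph, two closed walks can be merged unless one strictly dominates
the other. -/
theorem ClosedWalk.dominates (hR : ∀ x y, x ≠ y → R x y ∨ R y x) {s t : Multiset α}
    (hs : ClosedWalk R s) (ht : ClosedWalk R t) (hst : ¬ ClosedWalk R (s + t)) :
    Dominates R s t ∨ Dominates R t s := by
  rcases le_total s.card t.card with h | h
  · exact hs.dominates_of_card_le hR ht hst h
  · exact (ht.dominates_of_card_le hR hs (by rwa [add_comm]) h).symm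

theorem Walk.left_mem {a b : α} {s : Multiset α} (w : Walk R a b s) : a ∈ s := by
  cases w <;> simp

theorem Walk.right_mem {a b : α} {s : Multiset α} (w : Walk R a b s) : b ∈ s := by
  induction w <;> simp_all

theorem ClosedWalk.exists_mem {s : Multiset α} (w : ClosedWalk R s) : ∃ x, x ∈ s := by
  obtain ⟨a, b, w, -⟩ := w
  exact ⟨a, w.left_mem⟩

theorem ClosedWalk.add_of_dominates {s t u : Multiset α} (hs : ClosedWalk R s)
    (ht : ClosedWalk R t) (hu : ClosedWalk R u) (hst : Dominates R s t) (htu : Dominates R t u)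
    (hus : Dominates R u s) : ClosedWalk R (s + t + u) := by
  obtain ⟨a, b, ws, -⟩ := hs
  obtain ⟨c, d, wt, -⟩ := ht
  obtain ⟨e, f, wu, -⟩ := hu
  exact ⟨a, f, (ws.append (hst _ ws.right_mem _ wt.left_mem).1 wt).append
    (htu _ wt.right_mem _ wu.left_mem).1 wu, (hus _ wu.right_mem _ ws.left_mem).1⟩

theorem Dominates.disjoint {s t : Multiset α} (h : Dominates R s t) {x : α} (hs : x ∈ s)
    (ht : x ∈ t) : False :=
  (h x hs x ht).2 (h x hs x ht).1

theorem exists_eq_cons_cons {β : Type*} {S : Multiset β} {s t : β} (hs : s ∈ S) (ht : t ∈ S)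
    (hst : s ≠ t) : ∃ S', S = s ::ₘ t ::ₘ S' := by
  obtain ⟨S₁, rfl⟩ := Multiset.exists_cons_of_mem hs
  obtain ⟨S₂, rfl⟩ := Multiset.exists_cons_of_mem ((Multiset.mem_cons.1 ht).resolve_left hst.symm)
  exact ⟨S₂, rfl⟩

/-- Closed walks covering all vertices of a strong semicomplete digraph can be merged into a
single closed walk. -/
theorem ClosedWalk.sum (hR : ∀ x y, x ≠ y → R x y ∨ R y x)
    (hstrong : ∀ x y, Relation.ReflTransGen R x y) {S : Multiset (Multiset α)} (hS0 : S ≠ 0)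
    (hS : ∀ s ∈ S, ClosedWalk R s) (hcov : ∀ x, ∃ s ∈ S, x ∈ s) : ClosedWalk R S.sum := by
  induction hn : S.card using Nat.strong_induction_on generalizing S with
  | _ n ih =>
  subst hn
  -- Induction on the number of walks: any pair or triple that merges is replaced by its sum.
  by_cases hpair : ∃ s t S', S = s ::ₘ t ::ₘ S' ∧ ClosedWalk R (s + t)
  · obtain ⟨s, t, S', rfl, hst⟩ := hpair
    have := ih _ (by simp) (S := (s + t) ::ₘ S') (by simp)
      (by simp only [Multiset.mem_cons, forall_eq_or_imp] at hS ⊢; exact ⟨hst, hS.2.2⟩)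
      (by
        intro x
        obtain ⟨u, hu, hx⟩ := hcov x
        simp only [Multiset.mem_cons] at hu
        rcases hu with rfl | rfl | hu
        · exact ⟨_, Multiset.mem_cons_self _ _, by simp [hx]⟩
        · exact ⟨_, Multiset.mem_cons_self _ _, by simp [hx]⟩
        · exact ⟨u, by simp [hu], hx⟩) rfl
    simpa [add_assoc] using this
  push Not at hpair
  have hdom : ∀ s ∈ S, ∀ t ∈ S, s ≠ t → Dominates R s t ∨ Dominates R t s := by
    intro s hs t ht hst
    obtain ⟨S', rfl⟩ := exists_eq_cons_cons hs ht hst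
    exact (hS s hs).dominates hR (hS t ht) (hpair s t S' rfl)
  by_cases htriple : ∃ s t u S', S = s ::ₘ t ::ₘ u ::ₘ S' ∧ ClosedWalk R (s + t + u)
  · obtain ⟨s, t, u, S', rfl, hst⟩ := htriple
    have := ih _ (by simp) (S := (s + t + u) ::ₘ S') (by simp)
      (by simp only [Multiset.mem_cons, forall_eq_or_imp] at hS ⊢; exact ⟨hst, hS.2.2.2⟩)
      (by
        intro x
        obtain ⟨v, hv, hx⟩ := hcov x
        simp only [Multiset.mem_cons] at hv
        rcases hv with rfl | rfl | rfl | hv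
        · exact ⟨_, Multiset.mem_cons_self _ _, by simp [hx]⟩
        · exact ⟨_, Multiset.mem_cons_self _ _, by simp [hx]⟩
        · exact ⟨_, Multiset.mem_cons_self _ _, by simp [hx]⟩
        · exact ⟨v, by simp [hv], hx⟩) rfl
    simpa [add_assoc] using this
  push Not at htriple
  have hno3 : ∀ s ∈ S, ∀ t ∈ S, ∀ u ∈ S, Dominates R s t → Dominates R t u →
      ¬ Dominates R u s := by
    intro s hs t ht u hu hst htu hus
    obtain ⟨x, hx⟩ := (hS s hs).exists_mem
    obtain ⟨y, hy⟩ := (hS t ht).exists_mem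
    have h1 : s ≠ t := by rintro rfl; exact hst.disjoint hx hx
    have h2 : t ≠ u := by rintro rfl; exact htu.disjoint hy hy
    have h3 : u ≠ s := by rintro rfl; exact hus.disjoint hx hx
    obtain ⟨S', rfl⟩ := exists_eq_cons_cons hs ht h1
    simp only [Multiset.mem_cons, h3, h2.symm, false_or] at hu
    obtain ⟨S'', rfl⟩ := Multiset.exists_cons_of_mem hu
    exact htriple s t u S'' rfl
      ((hS _ (by simp)).add_of_dominates (hS _ (by simp)) (hS _ (by simp)) hst htu hus)
  have hno2 : ∀ s ∈ S, ∀ t ∈ S, Dominates R t s → False := by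
    intro s hs t ht hts
    obtain ⟨x, hx⟩ := (hS s hs).exists_mem
    obtain ⟨y, hy⟩ := (hS t ht).exists_mem
    -- The vertices of `s` and of the walks dominated by `s` are closed under outgoing arcs, so a
    -- walk dominating `s` cannot be reached from `s`.
    have key : y ∈ s ∨ ∃ u ∈ S, y ∈ u ∧ Dominates R s u := by
      clear hy hts
      induction hstrong x y with
      | refl => exact .inl hx
      | @tail z w _ hzw hz =>
        obtain ⟨u, hu, hw⟩ := hcov w
        rcases eq_or_ne u s with rfl | hus
        · exact .inl hw
        rcases hdom u hu s hs hus with h | h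
        · exfalso
          rcases hz with hz | ⟨v, hv, hz, hsv⟩
          · exact (h w hw z hz).2 hzw
          · rcases eq_or_ne v u with rfl | hvu
            · obtain ⟨x', hx'⟩ := (hS s hs).exists_mem
              exact (h w hw x' hx').2 (hsv x' hx' w hw).1
            · rcases hdom v hv u hu hvu with h' | h'
              · exact hno3 s hs v hv u hu hsv h' h
              · exact (h' w hw z hz).2 hzw
        · exact .inr ⟨u, hu, hw, h⟩
    rcases key with h | ⟨u, hu, hyu, hsu⟩
    · exact hts.disjoint hy h
    · rcases eq_or_ne u t with rfl | hut
      · exact (hts y hy x hx).2 (hsu x hx y hy).1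
      · rcases hdom u hu t ht hut with h | h
        · exact h.disjoint hyu hy
        · exact h.disjoint hy hyu
  obtain ⟨s, hs⟩ := Multiset.exists_mem_of_ne_zero hS0
  obtain ⟨S₁, rfl⟩ := Multiset.exists_cons_of_mem hs
  rcases S₁.empty_or_exists_mem with rfl | ⟨t, ht⟩
  · simpa using hS s hs
  · obtain ⟨S₂, rfl⟩ := Multiset.exists_cons_of_mem ht
    exfalso
    rcases (hS s hs).dominates hR (hS t (by simp)) (hpair s t S₂ rfl) with h | h
    · exact hno2 t (by simp) s hs h
    · exact hno2 s hs t (by simp) h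

end Walks

/-! ### Walks as lists and cycles; partitions into paths -/

section Walks

variable {α : Type*} {R : α → α → Prop}

theorem Walk.exists_list {a b : α} {s : Multiset α} (w : Walk R a b s) :
    ∃ l : List α, ((a :: l : List α) : Multiset α) = s ∧
      ∀ c, R b c → List.IsChain R (a :: (l ++ [c])) := by
  induction w with
  | single a => exact ⟨[], rfl, fun c h => by simpa using h⟩
  | @cons a b c s h _ ih =>
    obtain ⟨l, rfl, hl⟩ := ih
    exact ⟨b :: l, rfl, fun d hd => List.isChain_cons_cons.2 ⟨h, hl d hd⟩⟩

theorem exists_walk_of_isChain (l : List α) {a c : α} (h : List.IsChain R (a :: (l ++ [c]))) :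
    ∃ b, Walk R a b (a :: l : List α) ∧ R b c := by
  induction l generalizing a with
  | nil => exact ⟨a, .single a, by simpa using h⟩
  | cons d l ih =>
    obtain ⟨h1, h2⟩ := List.isChain_cons_cons.1 h
    obtain ⟨b, w, hb⟩ := ih h2
    exact ⟨b, .cons h1 w, hb⟩

theorem closedWalk_iff_exists_cycle {s : Multiset α} :
    ClosedWalk R s ↔ ∃ c : Cycle α, c ≠ Cycle.nil ∧ c.Chain R ∧ c.toMultiset = s := by
  constructor
  · rintro ⟨a, b, w, h⟩
    obtain ⟨l, rfl, hl⟩ := w.exists_list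
    exact ⟨(a :: l : List α), by simp, (Cycle.chain_coe_cons R a l).2 (hl a h), rfl⟩
  · rintro ⟨c, hc, h, rfl⟩
    induction c using Quotient.inductionOn' with
    | _ l =>
    cases l with
    | nil => exact absurd rfl hc
    | cons a l =>
      obtain ⟨b, w, hb⟩ := exists_walk_of_isChain l ((Cycle.chain_coe_cons R a l).1 h)
      exact ⟨a, b, w, hb⟩

theorem Walk.exists_isChain {a b : α} {s : Multiset α} (w : Walk R a b s) :
    ∃ l : List α, l ≠ [] ∧ (l : Multiset α) = s ∧ l.IsChain R := by
  have : ∃ l : List α, ((a :: l : List α) : Multiset α) = s ∧ List.IsChain R (a :: l) := by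
    induction w with
    | single a => exact ⟨[], rfl, by simp⟩
    | @cons a b c s h _ ih =>
      obtain ⟨l, rfl, hl⟩ := ih
      exact ⟨b :: l, rfl, List.isChain_cons_cons.2 ⟨h, hl⟩⟩
  obtain ⟨l, h1, h2⟩ := this
  exact ⟨a :: l, by simp, h1, h2⟩

theorem exists_walk_of_ne_nil {l : List α} (hl : l ≠ []) (h : l.IsChain R) :
    ∃ a b, Walk R a b (l : Multiset α) := by
  have key : ∀ (l : List α) (a : α), (a :: l).IsChain R →
      ∃ b, Walk R a b (a :: l : List α) := by
    intro l
    induction l with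
    | nil => exact fun a _ => ⟨a, .single a⟩
    | cons d l ih =>
      intro a h
      obtain ⟨h1, h2⟩ := List.isChain_cons_cons.1 h
      obtain ⟨b, w⟩ := ih d h2
      exact ⟨b, .cons h1 w⟩
  cases l with
  | nil => exact absurd rfl hl
  | cons a l => exact ⟨a, key l a h⟩

/-- `PartitionsIntoPaths R k s`: the multiset `s` is the union of `k` paths. -/
def PartitionsIntoPaths (R : α → α → Prop) (k : ℕ) (s : Multiset α) : Prop :=
  ∃ P : Multiset (Multiset α), P.card = k ∧ (∀ p ∈ P, ∃ a b, Walk R a b p) ∧ P.sum = s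

theorem card_le_card_sum {P : Multiset (Multiset α)} (hP : ∀ p ∈ P, ∃ a b, Walk R a b p) :
    P.card ≤ P.sum.card := by
  induction P using Multiset.induction_on with
  | empty => simp
  | cons p P ih =>
    have h1 := ih fun q hq => hP q (by simp [hq])
    obtain ⟨a, b, w⟩ := hP p (by simp)
    have h2 := Multiset.card_pos_iff_exists_mem.2 ⟨a, w.left_mem⟩
    simp only [Multiset.card_cons, Multiset.sum_cons, Multiset.card_add]
    omega

theorem PartitionsIntoPaths.le_card {k : ℕ} {s : Multiset α} (h : PartitionsIntoPaths R k s) :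
    k ≤ s.card := by
  obtain ⟨P, rfl, hP, rfl⟩ := h
  exact card_le_card_sum hP

/-- Some part has more than one vertex, and its first vertex can be split off. -/
theorem PartitionsIntoPaths.succ {k : ℕ} {s : Multiset α} (h : PartitionsIntoPaths R k s)
    (hk : k < s.card) : PartitionsIntoPaths R (k + 1) s := by
  obtain ⟨P, rfl, hP, rfl⟩ := h
  obtain ⟨p, hp, hcard⟩ : ∃ p ∈ P, 1 < p.card := by
    by_contra! hle
    have := Multiset.sum_le_card_nsmul (P.map Multiset.card) 1 (by simpa using hle)
    rw [Multiset.card_map, smul_eq_mul, mul_one, ← Multiset.card_join] at this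
    change P.sum.card ≤ _ at this
    omega
  obtain ⟨P', rfl⟩ := Multiset.exists_cons_of_mem hp
  obtain ⟨a, b, w⟩ := hP p hp
  cases w with
  | single => simp at hcard
  | @cons _ c _ s h w =>
    refine ⟨{a} ::ₘ s ::ₘ P', by simp, ?_, by simp [← Multiset.singleton_add, add_assoc]⟩
    simp only [Multiset.mem_cons, forall_eq_or_imp] at hP ⊢
    exact ⟨⟨a, a, .single a⟩, ⟨c, b, w⟩, hP.2⟩

theorem PartitionsIntoPaths.mono {k l : ℕ} {s : Multiset α} (h : PartitionsIntoPaths R k s)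
    (hkl : k ≤ l) (hl : l ≤ s.card) : PartitionsIntoPaths R l s := by
  induction l, hkl using Nat.le_induction with
  | base => exact h
  | succ l _ ih => exact (ih (by omega)).succ (by omega)

end Walks

namespace Digraph

/-! ### The path covering number in terms of multisets -/

section PathCovering

variable {V : Type*} [Fintype V] {D : Digraph V}

theorem IsPathFactor.partitionsIntoPaths {k : ℕ} {P : Fin k → List V} (hP : D.IsPathFactor P) :
    PartitionsIntoPaths D.Adj k (Finset.univ : Finset V).val := by
  classical
  refine ⟨Finset.univ.val.map fun a => (P a : Multiset V), by simp, ?_, ?_⟩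
  · simp only [Multiset.mem_map]
    rintro _ ⟨a, -, rfl⟩
    exact exists_walk_of_ne_nil (hP.isPath a).1 (hP.isPath a).2.2
  · change ∑ a, (P a : Multiset V) = _
    ext v
    obtain ⟨a, ha⟩ := hP.spanning v
    rw [Multiset.count_sum', Finset.sum_eq_single a]
    · rw [Multiset.count_eq_one_of_mem (Finset.univ.nodup) (Finset.mem_univ v), Multiset.coe_count]
      exact List.count_eq_one_of_mem (hP.isPath a).2.1 ha
    · intro b _ hb
      exact Multiset.count_eq_zero_of_notMem fun h => hP.disjoint a b hb.symm v ha h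
    · simp

theorem partitionsIntoPaths_pathCoveringNumber (D : Digraph V) :
    PartitionsIntoPaths D.Adj D.pathCoveringNumber (Finset.univ : Finset V).val := by
  obtain ⟨P, hP⟩ := Nat.sInf_mem (s := {k : ℕ | ∃ P : Fin k → List V, D.IsPathFactor P})
    ⟨_, D.exists_isPathFactor⟩
  exact hP.partitionsIntoPaths

theorem pathCoveringNumber_pos [Nonempty V] (D : Digraph V) : 0 < D.pathCoveringNumber := by
  obtain ⟨P, hcard, -, hsum⟩ := D.partitionsIntoPaths_pathCoveringNumber
  rw [← hcard, Multiset.card_pos]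
  rintro rfl
  have := congrArg Multiset.card hsum
  simp at this
  exact Fintype.card_ne_zero this.symm

/-- Disjointness and distinctness of vertices are not part of `PartitionsIntoPaths`; they follow
because the parts sum to a multiset without repetitions. -/
theorem pathCoveringNumber_le {k : ℕ}
    (h : PartitionsIntoPaths D.Adj k (Finset.univ : Finset V).val) :
    D.pathCoveringNumber ≤ k := by
  classical
  obtain ⟨P, rfl, hP, hsum⟩ := h
  obtain ⟨L, hL, hLP⟩ : ∃ L : List (List V), (∀ l ∈ L, l ≠ [] ∧ l.IsChain D.Adj) ∧
      ((L.map fun l => (l : Multiset V)) : Multiset (Multiset V)) = P := by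
    clear hsum
    induction P using Multiset.induction_on with
    | empty => exact ⟨[], by simp, rfl⟩
    | cons p P ih =>
      obtain ⟨L, hL, rfl⟩ := ih fun q hq => hP q (by simp [hq])
      obtain ⟨a, b, w⟩ := hP p (by simp)
      obtain ⟨l, h1, rfl, h2⟩ := w.exists_isChain
      exact ⟨l :: L, by simpa using ⟨⟨h1, h2⟩, hL⟩, rfl⟩
  have hflat : (L.flatten : Multiset V) = Finset.univ.val := by
    rw [← hsum, ← hLP]
    clear hL hLP
    induction L with
    | nil => rfl
    | cons l L ih => simp_all [← Multiset.coe_add]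
  have hnodup : L.flatten.Nodup := by
    rw [← Multiset.coe_nodup, hflat]
    exact Finset.univ.nodup
  rw [List.nodup_flatten] at hnodup
  have hcard : P.card = L.length := by simp [← hLP]
  rw [hcard]
  refine Nat.sInf_le ⟨L.get, fun a => ?_, fun a b hab v hva hvb => ?_, fun v => ?_⟩
  · have := hL _ (L.get_mem a)
    exact ⟨this.1, hnodup.1 _ (L.get_mem a), this.2⟩
  · rcases lt_or_gt_of_ne hab with h | h
    · exact List.pairwise_iff_get.1 hnodup.2 a b h hva hvb
    · exact List.pairwise_iff_get.1 hnodup.2 b a h hvb hva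
  · have hv : v ∈ L.flatten := by
      rw [← Multiset.mem_coe, hflat]
      exact Finset.mem_univ v
    obtain ⟨l, hl, hvl⟩ := List.mem_flatten.1 hv
    obtain ⟨a, rfl⟩ := List.get_of_mem hl
    exact ⟨a, hvl⟩

end PathCovering

/-! ### Passing between walks of `T` and walks of the composition -/

section Composition

open scoped Classical in
/-- Substitution of paths of the `H i` for the vertices of a walk of `T`. -/
theorem walk_composition {ι : Type*} {V : ι → Type*} {T : Digraph ι} {H : ∀ i, Digraph (V i)}
    {i j : ι} {s : Multiset ι} (w : Walk T.Adj i j s) (P : ∀ i, Multiset (Multiset (V i)))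
    (hcard : ∀ k, (P k).card = s.count k)
    (hP : ∀ k, ∀ p ∈ P k, ∃ a b, Walk (H k).Adj a b p) :
    ∃ (x : V i) (y : V j) (u : Multiset (Σ i, V i)),
      Walk (T.composition H).Adj ⟨i, x⟩ ⟨j, y⟩ u ∧ ∀ k v, u.count ⟨k, v⟩ = (P k).sum.count v := by
  have inside : ∀ {k : ι} {a b : V k} {p : Multiset (V k)}, Walk (H k).Adj a b p →
      Walk (T.composition H).Adj ⟨k, a⟩ ⟨k, b⟩ (p.map (Sigma.mk k)) := by
    intro k a b p w
    induction w with
    | single a => exact .single _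
    | cons h _ ih =>
      rw [Multiset.map_cons]
      exact .cons (.inside h) ih
  have count_same : ∀ {k : ι} (p : Multiset (V k)) (v : V k),
      (p.map (Sigma.mk k)).count ⟨k, v⟩ = p.count v := fun p v =>
    Multiset.count_map_eq_count' _ _ sigma_mk_injective _
  have count_ne : ∀ {k l : ι} (p : Multiset (V k)) (v : V l), k ≠ l →
      (p.map (Sigma.mk k)).count ⟨l, v⟩ = 0 := by
    intro k l p v hkl
    refine Multiset.count_eq_zero_of_notMem ?_
    simp only [Multiset.mem_map, not_exists, not_and]
    intro a _ h
    exact hkl (congrArg Sigma.fst h)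
  induction w generalizing P with
  | single i =>
    obtain ⟨p, hp⟩ := Multiset.card_eq_one.1 ((hcard i).trans (by simp))
    obtain ⟨a, b, w⟩ := hP i p (by simp [hp])
    refine ⟨a, b, _, inside w, fun k v => ?_⟩
    rcases eq_or_ne i k with rfl | hik
    · rw [count_same, hp]
      simp
    · have : P k = 0 := by
        rw [← Multiset.card_eq_zero, hcard]
        simp [hik.symm]
      rw [count_ne _ _ hik, this]
      simp
  | @cons i j k s h _ ih =>
    obtain ⟨p, hp⟩ := Multiset.card_pos_iff_exists_mem.1
      (show 0 < (P i).card by rw [hcard]; simp)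
    obtain ⟨P', hP'⟩ := Multiset.exists_cons_of_mem hp
    obtain ⟨a, b, w⟩ := hP i p hp
    -- The path `p` serves the first visit to `i`, so it is removed from the supply for the
    -- remaining visits.
    obtain ⟨x, y, u, wu, hu⟩ := ih (Function.update P i P')
      (by
        intro l
        have := hcard l
        rcases eq_or_ne l i with rfl | hl
        · simpa [hP'] using this
        · simpa [hl] using this)
      (by
        intro l q hq
        rcases eq_or_ne l i with rfl | hl
        · exact hP l q (by rw [hP']; simp_all)
        · exact hP l q (by simpa [hl] using hq))
    refine ⟨a, y, _, (inside w).append (.across h) wu, fun l v => ?_⟩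
    rw [Multiset.count_add, hu]
    rcases eq_or_ne i l with rfl | hl
    · rw [count_same, hP']
      simp
    · rw [count_ne _ _ hl]
      simp [hl.symm]

-- Converse of the substitution: the walk is cut at its `across` arcs. The last conjunct strengthens
-- the induction: some piece starts at the initial vertex, so an `inside` arc can be prepended to
-- it.
open scoped Classical in
theorem exists_walk_of_walk_composition {ι : Type*} {V : ι → Type*} {T : Digraph ι}
    {H : ∀ i, Digraph (V i)} {x y : Σ i, V i} {u : Multiset (Σ i, V i)}
    (w : Walk (T.composition H).Adj x y u) :
    ∃ (s : Multiset ι) (P : ∀ i, Multiset (Multiset (V i))), Walk T.Adj x.1 y.1 s ∧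
      (∀ k, (P k).card = s.count k) ∧ (∀ k, ∀ p ∈ P k, ∃ a b, Walk (H k).Adj a b p) ∧
      (∀ k v, u.count ⟨k, v⟩ = (P k).sum.count v) ∧
      ∃ p ∈ P x.1, ∃ b, Walk (H x.1).Adj x.2 b p := by
  have count_cons : ∀ (u : Multiset (Σ i, V i)) {k l : ι} (a : V k) (v : V l),
      Multiset.count (⟨l, v⟩ : Σ i, V i) (⟨k, a⟩ ::ₘ u) =
        u.count ⟨l, v⟩ + if h : k = l then if h ▸ a = v then 1 else 0 else 0 := by
    intro u k l a v
    rw [Multiset.count_cons]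
    congr 1
    by_cases h : k = l
    · subst h
      simp [eq_comm]
    · rw [dif_neg h, if_neg]
      exact fun h' => h (congrArg Sigma.fst h').symm
  induction w with
  | single x =>
    obtain ⟨i, x⟩ := x
    refine ⟨{i}, Function.update (fun _ => 0) i {{x}}, .single i, ?_, ?_, ?_,
      {x}, by simp, x, .single x⟩
    · intro k
      rcases eq_or_ne k i with rfl | hk
      · simp
      · simp [hk]
    · intro k p hp
      rcases eq_or_ne k i with rfl | hk
      · simp only [Function.update_self, Multiset.mem_singleton] at hp
        exact ⟨x, x, hp ▸ .single x⟩
      · simp [hk] at hp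
    · intro k v
      rw [← Multiset.cons_zero, count_cons]
      rcases eq_or_ne i k with rfl | hk
      · simp [Multiset.count_singleton, eq_comm]
      · simp [hk, hk.symm]
  | @cons x y z u h _ ih =>
    obtain ⟨s, P, w, hcard, hP, hu, p, hp, b, wp⟩ := ih
    cases h with
    | @inside i x y h =>
      obtain ⟨P', hP'⟩ := Multiset.exists_cons_of_mem hp
      refine ⟨s, Function.update P i ((x ::ₘ p) ::ₘ P'), w, ?_, ?_, ?_,
        x ::ₘ p, by simp, b, .cons h wp⟩
      · intro k
        rw [← hcard]
        rcases eq_or_ne k i with rfl | hk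
        · simp [hP']
        · simp [hk]
      · intro k q hq
        rcases eq_or_ne k i with rfl | hk
        · simp only [Function.update_self, Multiset.mem_cons] at hq
          rcases hq with rfl | hq
          · exact ⟨x, b, .cons h wp⟩
          · exact hP k q (by rw [hP']; simp [hq])
        · exact hP k q (by simpa [hk] using hq)
      · intro k v
        rw [count_cons, hu]
        rcases eq_or_ne i k with rfl | hk
        · simp [hP', Multiset.count_cons, eq_comm]
        · simp [hk, hk.symm]
    | @across i j x y h =>
      refine ⟨i ::ₘ s, Function.update P i ({x} ::ₘ P i), .cons h w, ?_, ?_, ?_,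
        {x}, by simp, x, .single x⟩
      · intro k
        rcases eq_or_ne k i with rfl | hk
        · simp [hcard]
        · simp [hcard, hk]
      · intro k q hq
        rcases eq_or_ne k i with rfl | hk
        · simp only [Function.update_self, Multiset.mem_cons] at hq
          rcases hq with rfl | hq
          · exact ⟨x, x, .single x⟩
          · exact hP k q hq
        · exact hP k q (by simpa [hk] using hq)
      · intro k v
        rw [count_cons, hu]
        rcases eq_or_ne i k with rfl | hk
        · simp [Multiset.count_cons, eq_comm]
        · simp [hk, hk.symm]

/-- Opening at an arc of `T` lets the contracted walk close up in `T`. Such an arc exists, since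
otherwise the walk would stay in one part. -/
theorem exists_walk_across {ι : Type*} {V : ι → Type*} {T : Digraph ι} {H : ∀ i, Digraph (V i)}
    {u : Multiset (Σ i, V i)} (w : ClosedWalk (T.composition H).Adj u)
    (hu : ∃ x ∈ u, ∃ y ∈ u, x.1 ≠ y.1) :
    ∃ x y, Walk (T.composition H).Adj x y u ∧ T.Adj y.1 x.1 := by
  obtain ⟨m, f, hf, hfR, rfl⟩ := w.exists_periodic
  by_cases hex : ∃ k, T.Adj (f k).1 (f (k + 1)).1
  · obtain ⟨k, hk⟩ := hex
    exact ⟨_, _, walk_of_periodic hf hfR k, hk⟩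
  · exfalso
    push Not at hex
    have hstep : ∀ k, (f (k + 1)).1 = (f k).1 := by
      intro k
      have h1 := hfR k
      have h2 := hex k
      generalize f k = x at *
      generalize f (k + 1) = y at *
      cases h1 with
      | inside => rfl
      | across h => exact absurd h h2
    have hconst : ∀ k, (f k).1 = (f 0).1 := by
      intro k
      induction k with
      | zero => rfl
      | succ k ih => rw [hstep, ih]
    simp only [Multiset.mem_map] at hu
    obtain ⟨_, ⟨k, -, rfl⟩, _, ⟨l, -, rfl⟩, h⟩ := hu
    exact h ((hconst k).trans (hconst l).symm)

theorem IsStrong.of_composition {ι : Type*} {V : ι → Type*} [∀ i, Nonempty (V i)]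
    {T : Digraph ι} {H : ∀ i, Digraph (V i)} (h : (T.composition H).IsStrong) : T.IsStrong := by
  have key : ∀ x y : Σ i, V i, Relation.ReflTransGen (T.composition H).Adj x y →
      Relation.ReflTransGen T.Adj x.1 y.1 := by
    intro x y hxy
    induction hxy with
    | refl => exact .refl
    | tail _ h ih =>
      cases h with
      | inside => exact ih
      | across h => exact ih.tail h
  intro i j
  exact key ⟨i, Classical.arbitrary _⟩ ⟨j, Classical.arbitrary _⟩ (h _ _)

theorem mem_toMultiset {V : Type*} {c : Cycle V} {x : V} : x ∈ c.toMultiset ↔ x ∈ c := by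
  induction c using Quotient.inductionOn' with
  | _ l => exact Iff.rfl

/-- A closed walk without repeated vertices, not all in the same part, is a cycle. -/
theorem exists_isCycle_of_closedWalk {ι : Type*} {V : ι → Type*} {D : Digraph (Σ i, V i)}
    {u : Multiset (Σ i, V i)} (w : ClosedWalk D.Adj u) (hnodup : u.Nodup)
    (hu : ∃ x ∈ u, ∃ y ∈ u, x.1 ≠ y.1) :
    ∃ c : Cycle (Σ i, V i), D.IsCycle c ∧ ∀ x, x ∈ c ↔ x ∈ u := by
  obtain ⟨c, -, hchain, rfl⟩ := closedWalk_iff_exists_cycle.1 w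
  obtain ⟨x, hx, y, hy, hxy⟩ := hu
  refine ⟨c, ⟨⟨x, y, fun h => hxy (congrArg _ h), mem_toMultiset.1 hx, mem_toMultiset.1 hy⟩,
    ?_, hchain⟩, fun x => mem_toMultiset.symm⟩
  induction c using Quotient.inductionOn' with
  | _ l => exact hnodup

theorem IsCycle.closedWalk {V : Type*} {D : Digraph V} {c : Cycle V} (h : D.IsCycle c) :
    ClosedWalk D.Adj c.toMultiset := by
  refine closedWalk_iff_exists_cycle.2 ⟨c, ?_, h.2.2, rfl⟩
  rintro rfl
  obtain ⟨x, _, _, hx, _⟩ := h.1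
  exact Cycle.notMem_nil x hx

theorem IsCycle.nodup_toMultiset {V : Type*} {D : Digraph V} {c : Cycle V} (h : D.IsCycle c) :
    c.toMultiset.Nodup := by
  have := h.2.1
  induction c using Quotient.inductionOn' with
  | _ l => exact this

end Composition

end Digraph

/-! ### The main equivalence -/

theorem mainTheorem3 {ι : Type*} [Fintype ι] {V : ι → Type*} [∀ i, Fintype (V i)]
    [∀ i, Nonempty (V i)] (T : Digraph ι) (H : ∀ i, Digraph (V i))
    (hι : 2 ≤ Fintype.card ι) (hT : T.IsLoopless) (hH : ∀ i, (H i).IsLoopless)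
    (hsemi : T.IsSemicomplete) (hstrong : (T.composition H).IsStrong) :
    (T.composition H).IsHamiltonian ↔
      ∃ (m : ℕ) (F : Fin m → Cycle (Σ i, Fin (Fintype.card (V i)))),
        (T.extension fun i => Fintype.card (V i)).IsCycleSubdigraph F ∧
          ∀ i, (H i).pathCoveringNumber ≤
            {x : Fin (Fintype.card (V i)) | ∃ a, Sigma.mk i x ∈ F a}.ncard := by
  classical
  obtain ⟨i₀, j₀, hij⟩ : ∃ i j : ι, i ≠ j := Fintype.exists_pair_of_one_lt_card hι
  constructor
  · rintro ⟨c, hc, hmem⟩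
    obtain ⟨x, y, w, hyx⟩ := Digraph.exists_walk_across hc.closedWalk
      ⟨⟨i₀, Classical.arbitrary _⟩, Digraph.mem_toMultiset.2 (hmem _),
        ⟨j₀, Classical.arbitrary _⟩, Digraph.mem_toMultiset.2 (hmem _), hij⟩
    obtain ⟨s, P, ws, hcard, hP, hu, -⟩ := Digraph.exists_walk_of_walk_composition w
    have hpart : ∀ i, PartitionsIntoPaths (H i).Adj (s.count i)
        (Finset.univ : Finset (V i)).val := by
      intro i
      refine ⟨P i, hcard i, hP i, ?_⟩
      ext v
      rw [← hu, Multiset.count_eq_one_of_mem Finset.univ.nodup (Finset.mem_univ v),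
        Multiset.count_eq_one_of_mem hc.nodup_toMultiset (Digraph.mem_toMultiset.2 (hmem _))]
    have hle : ∀ i, s.count i ≤ Fintype.card (V i) := fun i => (hpart i).le_card
    have hA : ∀ i, ∃ A : Finset (Fin (Fintype.card (V i))), A.card = s.count i := fun i => by
      obtain ⟨A, -, hA⟩ := Finset.exists_subset_card_eq
        (s := (Finset.univ : Finset (Fin (Fintype.card (V i))))) (n := s.count i)
        (by simpa using hle i)
      exact ⟨A, hA⟩
    choose A hA using hA
    -- Each visit to `i` receives its own copy from `A i`, as a one-vertex path, so no vertex
    -- repeats.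
    obtain ⟨a, b, u, wu, hucount⟩ := Digraph.walk_composition
      (H := fun i => Digraph.emptyDigraph (Fin (Fintype.card (V i)))) ws
      (fun i => (A i).val.map fun a => {a}) (fun i => by simpa using hA i)
      (fun i p hp => by
        obtain ⟨a, -, rfl⟩ := Multiset.mem_map.1 hp
        exact ⟨a, a, .single a⟩)
    replace hucount : ∀ i x, u.count ⟨i, x⟩ = (A i).val.count x := by
      intro i x
      convert hucount i x using 2
      exact (Multiset.sum_map_singleton _).symm
    have humem : ∀ i x, (⟨i, x⟩ : Σ i, Fin (Fintype.card (V i))) ∈ u ↔ x ∈ A i := by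
      intro i x
      rw [← Multiset.count_pos, hucount, Multiset.count_pos, Finset.mem_val]
    -- Every part is visited, so the closed walk has vertices in two parts and is a genuine cycle.
    have hpos : ∀ i, 0 < s.count i := fun i =>
      (H i).pathCoveringNumber_pos.trans_le (Digraph.pathCoveringNumber_le (hpart i))
    have hne : ∀ i, ∃ x, x ∈ A i := fun i => Finset.card_pos.1 (by rw [hA]; exact hpos i)
    obtain ⟨d, hd, hdu⟩ := Digraph.exists_isCycle_of_closedWalk
      (D := T.extension fun i => Fintype.card (V i)) (u := u) ⟨_, _, wu, .across hyx⟩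
      (by
        rw [Multiset.nodup_iff_count_le_one]
        rintro ⟨i, x⟩
        rw [hucount]
        exact Multiset.nodup_iff_count_le_one.1 (A i).nodup x)
      (by
        obtain ⟨x, hx⟩ := hne i₀
        obtain ⟨y, hy⟩ := hne j₀
        exact ⟨_, (humem _ _).2 hx, _, (humem _ _).2 hy, hij⟩)
    refine ⟨1, fun _ => d, ⟨fun _ => hd, fun a b h => absurd (Subsingleton.elim a b) h⟩,
      fun i => ?_⟩
    have : {x : Fin (Fintype.card (V i)) | ∃ a : Fin 1, Sigma.mk i x ∈ d} = (A i : Set _) := by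
      ext x
      simp [hdu, humem]
    rw [this, Set.ncard_coe_finset, hA]
    exact Digraph.pathCoveringNumber_le (hpart i)
  · rintro ⟨m, F, hF, hpc⟩
    have hproj : ∀ a, ClosedWalk T.Adj ((F a).toMultiset.map Sigma.fst) := by
      intro a
      have := (hF.isCycle a).closedWalk
      generalize (F a).toMultiset = s at this
      obtain ⟨x, y, w, h⟩ := this
      have key : ∀ {x y}, (T.extension fun i => Fintype.card (V i)).Adj x y → T.Adj x.1 y.1 := by
        rintro _ _ (⟨h⟩ | ⟨h⟩)
        · exact h.elim
        · exact h
      refine ⟨x.1, y.1, ?_, key h⟩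
      clear h
      induction w with
      | single x => exact .single _
      | cons h _ ih =>
        rw [Multiset.map_cons]
        exact .cons (key h) ih
    set M : Multiset (Σ i, Fin (Fintype.card (V i))) := ∑ a, (F a).toMultiset with hM
    have hMmem : ∀ x, x ∈ M ↔ ∃ a, x ∈ F a := by
      intro x
      simp [hM, Multiset.mem_sum, Digraph.mem_toMultiset]
    have hMnodup : M.Nodup := by
      rw [Multiset.nodup_iff_count_le_one]
      intro x
      rw [hM, Multiset.count_sum']
      by_cases hx : ∃ a, x ∈ F a
      · obtain ⟨a, ha⟩ := hx
        rw [Finset.sum_eq_single a]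
        · exact Multiset.nodup_iff_count_le_one.1 (hF.isCycle a).nodup_toMultiset x
        · intro b _ hb
          refine Multiset.count_eq_zero_of_notMem fun h => ?_
          exact hF.disjoint a b hb.symm x ha (Digraph.mem_toMultiset.1 h)
        · simp
      · rw [Finset.sum_eq_zero]
        · exact Nat.zero_le 1
        · intro a _
          exact Multiset.count_eq_zero_of_notMem fun h => hx ⟨a, Digraph.mem_toMultiset.1 h⟩
    set s : Multiset ι := M.map Sigma.fst with hs
    have hcount : ∀ i, s.count i =
        {x : Fin (Fintype.card (V i)) | ∃ a, Sigma.mk i x ∈ F a}.ncard := by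
      intro i
      have hinj : Function.Injective fun x =>
          (⟨i, x⟩ : Σ i, Fin (Fintype.card (V i))) := fun x y h => by simpa using h
      rw [hs, Multiset.count_map, ← Set.ncard_image_of_injective _ hinj,
        ← Multiset.toFinset_card_of_nodup (hMnodup.filter _), ← Set.ncard_coe_finset]
      congr 1
      ext ⟨j, x⟩
      simp only [Multiset.toFinset_filter, Finset.coe_filter, Multiset.mem_toFinset, hMmem,
        Set.mem_ofPred_eq, Set.mem_image]
      constructor
      · rintro ⟨h, rfl⟩
        exact ⟨x, h, rfl⟩
      · rintro ⟨y, h, hy⟩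
        cases hy
        exact ⟨h, rfl⟩
    have hpos : ∀ i, 0 < s.count i := fun i =>
      (H i).pathCoveringNumber_pos.trans_le ((hpc i).trans_eq (hcount i).symm)
    have hsum : ∑ a, (F a).toMultiset.map Sigma.fst = s := by
      rw [hs, hM]
      exact (map_sum (Multiset.mapAddMonoidHom Sigma.fst) (fun a => (F a).toMultiset)
        Finset.univ).symm
    have hcov : ∀ i, ∃ a, i ∈ (F a).toMultiset.map Sigma.fst := by
      intro i
      have := Multiset.count_pos.1 (hpos i)
      rw [← hsum, Multiset.mem_sum] at this
      obtain ⟨a, -, ha⟩ := this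
      exact ⟨a, ha⟩
    have hwalk : ClosedWalk T.Adj s := by
      rw [← hsum]
      refine ClosedWalk.sum hsemi (Digraph.IsStrong.of_composition hstrong) ?_ ?_ ?_
      · obtain ⟨a, -⟩ := hcov i₀
        intro h
        rw [Multiset.map_eq_zero, Finset.val_eq_zero] at h
        exact Finset.notMem_empty a (h ▸ Finset.mem_univ a)
      · simpa using hproj
      · intro i
        obtain ⟨a, ha⟩ := hcov i
        exact ⟨_, Multiset.mem_map_of_mem _ (Finset.mem_univ a), ha⟩
    -- The cycles use distinct copies of `i`, which bounds the count by `n i` and allows `mono`.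
    have hpart : ∀ i, PartitionsIntoPaths (H i).Adj (s.count i)
        (Finset.univ : Finset (V i)).val := by
      intro i
      refine (H i).partitionsIntoPaths_pathCoveringNumber.mono ((hpc i).trans_eq (hcount i).symm) ?_
      rw [hcount]
      refine (Set.ncard_le_card _).trans ?_
      simp
    choose P hcard hP hPsum using hpart
    obtain ⟨i, j, w, hji⟩ := hwalk
    obtain ⟨x, y, u, wu, hu⟩ := Digraph.walk_composition w P hcard hP
    have hu1 : ∀ x, u.count x = 1 := by
      rintro ⟨k, v⟩
      rw [hu, hPsum]
      exact Multiset.count_eq_one_of_mem Finset.univ.nodup (Finset.mem_univ v)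
    have humem : ∀ x, x ∈ u := fun x => Multiset.count_pos.1 (by rw [hu1]; exact one_pos)
    obtain ⟨c, hc, hcu⟩ := Digraph.exists_isCycle_of_closedWalk ⟨_, _, wu, .across hji⟩
      (Multiset.nodup_iff_count_le_one.2 fun x => (hu1 x).le)
      ⟨⟨i₀, Classical.arbitrary _⟩, humem _, ⟨j₀, Classical.arbitrary _⟩, humem _, hij⟩
    exact ⟨c, hc, fun v => (hcu v).2 (humem v)⟩
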